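/- Let $0<\alpha\le\frac12$ and $0<q\le\frac12$. Let $X_1\sim\mathrm{Bernoulli}(\frac12)$ and $X_m=X_{m-1}\oplus W_m$ for $m\ge 2$, where $\{W_m\}$ is an i.i.d. $\mathrm{Bernoulli}(q)$ process independent of $X_1$; let $\{Z_n\}$ be an i.i.d. $\mathrm{Bernoulli}(\alpha)$ process independent of $\{X_n\}$, and let $Y_n=X_n\oplus Z_n$. All entropies are in bits: $h(p)=-p\log_2 p-(1-p)\log_2(1-p)$, and $\overline H(Y)=\lim_{n\to\infty}\frac1n H(Y_1,\dots,Y_n)$. Put $\alpha*q=\alpha(1-q)+q(1-\alpha)$, $\eta=\frac{1-\alpha}{\alpha}$, $$g(F)=(1-\alpha*q)\frac{\eta F}{(1+\eta F)^2}+(\alpha*q)\frac{F/\eta}{(1+F/\eta)^2},\qquad F_{\max}=\frac{(\eta-1)(1-q)+\sqrt{4\eta q^2+(\eta-1)^2(1-q)^2}}{2\eta q}.$$ Let $\mathcal S^*$ be the set of solutions $s\in[1,F_{\max})$ of the quartic equation $$\eta\Big(\tfrac{1-\alpha*q}{\alpha*q}+\eta^2\Big)s^4+\Big(\tfrac{3\eta^2}{\alpha*q}-\eta^4-\tfrac{1-\alpha*q}{\alpha*q}\Big)s^3+3\eta\,\tfrac{1-2(\alpha*q)}{\alpha*q}(\eta^2-1)s^2+\Big(\tfrac{1-\alpha*q}{\alpha*q}\eta^4+1-\tfrac{3\eta^2}{\alpha*q}\Big)s-\eta\Big(1+\tfrac{1-\alpha*q}{\alpha*q}\eta^2\Big)=0.$$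 Then $g$ attains its minimum over $\mathcal S^*\cup\{F_{\max}\}$, the limit $\overline H(Y)$ exists, and for every minimizer $F^*$ of $g$ over $\mathcal S^*\cup\{F_{\max}\}$, $$\overline H(Y)\ \ge\ h(\alpha*q)+\big(1-h(\alpha*q)\big)\,g(F^*),$$ and, more strongly, $$\overline H(Y)\ \ge\ h(\alpha*q)+\big(1-h(\alpha*q)\big)\,4g(F^*).$$ -/

import Mathlib

open MeasureTheory ProbabilityTheory Filter Topology

noncomputable section

namespace HiddenMarkov

/-- The binary entropy function in bits (with the convention `0 log 0 = 0`). -/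
def h (p : ℝ) : ℝ := -(p * Real.logb 2 p) - (1 - p) * Real.logb 2 (1 - p)

/-- Binary convolution `a * b = a (1 - b) + b (1 - a)`. -/
def binConv (a b : ℝ) : ℝ := a * (1 - b) + b * (1 - a)

/-- Shannon entropy, in bits, of a random variable with values in a finite set. -/
def entropy {Ω S : Type*} [MeasurableSpace Ω] [Fintype S] (μ : Measure Ω) (V : Ω → S) : ℝ :=
  -∑ s : S, μ.real (V ⁻¹' {s}) * Real.logb 2 (μ.real (V ⁻¹' {s}))

/-- The normalized block entropy `H(Y₁, …, Yₙ) / n`; the process is indexed from `0`, so the block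
of length `n` is `(Y 0, …, Y (n - 1))`. -/
def blockEntropyRate {Ω : Type*} [MeasurableSpace Ω] (μ : Measure Ω) (Y : ℕ → Ω → Bool)
    (n : ℕ) : ℝ :=
  entropy μ (fun ω (i : Fin n) => Y i ω) / n

/-- `Y` has entropy rate `H`: the limit defining the entropy rate exists and equals `H`. -/
def HasEntropyRate {Ω : Type*} [MeasurableSpace Ω] (μ : Measure Ω) (Y : ℕ → Ω → Bool)
    (H : ℝ) : Prop :=
  Tendsto (blockEntropyRate μ Y) atTop (𝓝 H)

/-- `B` is an i.i.d. `Bernoulli(p)` process (`true` stands for the value `1`). -/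
structure IsBernoulliProcess {Ω : Type*} [MeasurableSpace Ω] (μ : Measure Ω)
    (B : ℕ → Ω → Bool) (p : ℝ) : Prop where
  measurable : ∀ n, Measurable (B n)
  prob : ∀ n, μ.real {ω | B n ω = true} = p
  indep : iIndepFun B μ

/-- `X` is the binary symmetric first-order Markov process with parameter `q`: it starts from a
fair bit and at every step is flipped by an i.i.d. `Bernoulli(q)` process independent of the
initial bit. -/
structure IsSymmetricMarkov {Ω : Type*} [MeasurableSpace Ω] (μ : Measure Ω)
    (X : ℕ → Ω → Bool) (q : ℝ) : Prop where
  measurable_init : Measurable (X 0)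
  prob_init : μ.real {ω | X 0 ω = true} = 1 / 2
  exists_flips : ∃ W : ℕ → Ω → Bool, IsBernoulliProcess μ W q ∧
    IndepFun (X 0) (fun ω m => W m ω) μ ∧
    ∀ m ω, X (m + 1) ω = xor (X m ω) (W m ω)

/-- `η = (1 - α) / α`. -/
def eta (α : ℝ) : ℝ := (1 - α) / α

/-- `g(F) = (1 - α*q) ηF / (1 + ηF)² + (α*q) (F/η) / (1 + F/η)²`. -/
def g (α q F : ℝ) : ℝ :=
  (1 - binConv α q) * (eta α * F / (1 + eta α * F) ^ 2)
    + binConv α q * ((F / eta α) / (1 + F / eta α) ^ 2)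

/-- `F_max`. -/
def Fmax (α q : ℝ) : ℝ :=
  ((eta α - 1) * (1 - q) + √(4 * eta α * q ^ 2 + (eta α - 1) ^ 2 * (1 - q) ^ 2))
    / (2 * eta α * q)

/-- The quartic polynomial whose roots `s > 0` are the critical points of `g`. -/
def quartic (α q s : ℝ) : ℝ :=
  eta α * ((1 - binConv α q) / binConv α q + eta α ^ 2) * s ^ 4
    + (3 * eta α ^ 2 * (1 / binConv α q) - eta α ^ 4 - (1 - binConv α q) / binConv α q) * s ^ 3
    + 3 * eta α * ((1 - 2 * binConv α q) / binConv α q) * (eta α ^ 2 - 1) * s ^ 2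
    + ((1 - binConv α q) / binConv α q * eta α ^ 4 + 1 - 3 * (eta α ^ 2 / binConv α q)) * s
    - eta α * (1 + (1 - binConv α q) / binConv α q * eta α ^ 2)

/-- `S* ∪ {F_max}`: the roots of the quartic in `[1, F_max)`, together with `F_max`. -/
def candidates (α q : ℝ) : Set ℝ :=
  {s | s ∈ Set.Ico 1 (Fmax α q) ∧ quartic α q s = 0} ∪ {Fmax α q}

/-- `F` is a minimizer of `g` over `S* ∪ {F_max}`. -/
def IsFstar (α q F : ℝ) : Prop :=
  F ∈ candidates α q ∧ IsMinOn (g α q) (candidates α q) F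

end HiddenMarkov

end

noncomputable section

namespace HiddenMarkov

/-! ### The binary entropy function -/

/-! Each output past is encoded by its joint weights with the two values of the next state. A new
output acts linearly on such pairs (`filterStep`), so block entropies are iterates of `sumOutputs`
at `stationary`, and their increments are conditional entropies. Concavity of entropy makes the
increments antitone; the rate is their limit, by Cesàro.

For the lower bound, let `x` be the posterior probability of state `1` after an observation. The
next output is `Bernoulli((α*q)*x)`, and the power series of `1 - h` gives `h(a*x) ≥ h(a) + (1 -
h(a)) 4x(1-x)` (`h_binConv_ge`). The odds never leave `[1/Fmax, Fmax]` (`filterStep_mem_oddsCone`).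
For prior odds `F ≥ 1` in this range, the mean of `x(1-x)` over the two outputs is at least `g F`
(`product_sum_ge_of_le`); odds below `1` follow by exchanging the states. Finally, the minimum of
`g` on `[1, Fmax]` is attained at a candidate (`exists_minimizer`). -/

lemma one_sub_h_mul (t : ℝ) (ht : |t| < 1) :
    (1 - h ((1 - t) / 2)) * (2 * Real.log 2)
      = (1 + t) * Real.log (1 + t) + (1 - t) * Real.log (1 - t) := by
  obtain ⟨h1, h2⟩ := abs_lt.1 ht
  have hl : Real.log 2 ≠ 0 := (Real.log_pos one_lt_two).ne'
  have e : 1 - (1 - t) / 2 = (1 + t) / 2 := by ring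
  unfold h
  rw [e, Real.logb, Real.logb, Real.log_div (by linarith) two_ne_zero,
    Real.log_div (by linarith) two_ne_zero]
  field_simp
  ring

/-- The value equals `t (log(1+t) - log(1-t)) + log(1-t²)`. What matters later is that the
coefficients are nonnegative and the powers even, starting at `t²`. -/
lemma hasSum_one_sub_h (t : ℝ) (ht : |t| < 1) :
    HasSum (fun k : ℕ => t ^ (2 * k + 2) * (1 / ((2 * k + 1) * (k + 1))))
      ((1 - h ((1 - t) / 2)) * (2 * Real.log 2)) := by
  obtain ⟨h1, h2⟩ := abs_lt.1 ht
  have ht2 : |t ^ 2| < 1 := by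
    rw [abs_pow]
    exact pow_lt_one₀ (abs_nonneg t) ht two_ne_zero
  have A := (Real.hasSum_log_sub_log_of_abs_lt_one ht).mul_left t
  have B := Real.hasSum_pow_div_log_of_abs_lt_one ht2
  have e : Real.log (1 - t ^ 2) = Real.log (1 - t) + Real.log (1 + t) := by
    rw [← Real.log_mul (by linarith) (by linarith)]
    ring_nf
  have hv : (1 - h ((1 - t) / 2)) * (2 * Real.log 2)
      = t * (Real.log (1 + t) - Real.log (1 - t)) - -Real.log (1 - t ^ 2) := by
    rw [one_sub_h_mul t ht, e]
    ring
  have hf : (fun k : ℕ => t ^ (2 * k + 2) * (1 / ((2 * k + 1) * (k + 1)))) = fun k : ℕ =>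
      t * (2 * (1 / (2 * (k : ℝ) + 1)) * t ^ (2 * k + 1)) - (t ^ 2) ^ (k + 1) / ((k : ℝ) + 1) := by
    ext k
    have h3 : (k : ℝ) + 1 ≠ 0 := by positivity
    have h4 : 2 * (k : ℝ) + 1 ≠ 0 := by positivity
    field_simp
    ring
  rw [hv, hf]
  exact A.sub B

lemma h_le_one {a : ℝ} (ha0 : 0 < a) (ha : a < 1) : h a ≤ 1 := by
  have ht : |1 - 2 * a| < 1 := abs_lt.2 ⟨by linarith, by linarith⟩
  have A := (hasSum_one_sub_h _ ht).nonneg fun k => by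
    have : 0 ≤ (1 - 2 * a) ^ (2 * k + 2) := Even.pow_nonneg ⟨k + 1, by ring⟩ _
    positivity
  rw [show (1 - (1 - 2 * a)) / 2 = a by ring] at A
  by_contra hc
  have : (1 - h a) * (2 * Real.log 2) < 0 :=
    mul_neg_of_neg_of_pos (by linarith) (by have := Real.log_pos one_lt_two; linarith)
  linarith

/-- Convolution with `x` keeps at least the fraction `4 x (1 - x)` of the missing entropy. -/
lemma h_binConv_ge {a x : ℝ} (ha0 : 0 < a) (ha : a < 1) (hx0 : 0 ≤ x) (hx : x ≤ 1) :
    h a + (1 - h a) * (4 * (x * (1 - x))) ≤ h (binConv a x) := by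
  -- Biases multiply under convolution: `1 - 2(a*x) = t s`. As `|s| ≤ 1`, each term of the series
  -- for `t s` is at most `s²` times the one for `t`, and `1 - s² = 4x(1-x)`.
  set t := 1 - 2 * a with ht
  set s := 1 - 2 * x with hs
  have ht1 : |t| < 1 := abs_lt.2 ⟨by linarith, by linarith⟩
  have hs1 : |s| ≤ 1 := abs_le.2 ⟨by linarith, by linarith⟩
  have hts : |t * s| < 1 := by
    rw [abs_mul]
    nlinarith [abs_nonneg t, abs_nonneg s]
  have A := (hasSum_one_sub_h t ht1).mul_left (s ^ 2)
  have B := hasSum_one_sub_h (t * s) hts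
  have C := hasSum_le (fun k => ?_) B A
  · rw [show (1 - t) / 2 = a by rw [ht]; ring,
      show (1 - t * s) / 2 = binConv a x by rw [ht, hs, binConv]; ring,
      ← mul_assoc (s ^ 2)] at C
    have := le_of_mul_le_mul_right C (by have := Real.log_pos one_lt_two; linarith)
    have e : s ^ 2 = 1 - 4 * (x * (1 - x)) := by rw [hs]; ring
    rw [e] at this
    linarith
  · rw [← mul_assoc]
    refine mul_le_mul_of_nonneg_right ?_ (by positivity)
    have h1 : s ^ (2 * k + 2) ≤ s ^ 2 := by
      rw [pow_add, pow_mul]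
      have : (s ^ 2) ^ k ≤ 1 := pow_le_one₀ (sq_nonneg s) (by rwa [sq_le_one_iff_abs_le_one])
      nlinarith [sq_nonneg s]
    rw [mul_pow, mul_comm]
    exact mul_le_mul_of_nonneg_right h1 (Even.pow_nonneg ⟨k + 1, by ring⟩ _)

/-! ### The minimum of `g` -/

lemma binConv_pos {α q : ℝ} (hα0 : 0 < α) (hα : α ≤ 1 / 2) (hq0 : 0 < q) (hq : q ≤ 1 / 2) :
    0 < binConv α q := by
  have h1 : 0 < 1 - q := by linarith
  have h2 : 0 < 1 - α := sub_pos.2 (hα.trans_lt one_half_lt_one)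
  unfold binConv
  positivity

lemma binConv_le_half {α q : ℝ} (hα : α ≤ 1 / 2) (hq : q ≤ 1 / 2) : binConv α q ≤ 1 / 2 := by
  unfold binConv
  nlinarith [mul_nonneg (sub_nonneg.2 hα) (sub_nonneg.2 hq)]

lemma one_le_eta {α : ℝ} (hα0 : 0 < α) (hα : α ≤ 1 / 2) : 1 ≤ eta α := by
  rw [eta, le_div_iff₀ hα0]
  linarith

lemma g_nonneg {α q F : ℝ} (hη : 0 < eta α) (ha0 : 0 ≤ binConv α q) (ha : binConv α q ≤ 1)
    (hF : 0 ≤ F) : 0 ≤ g α q F := by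
  have : 0 ≤ 1 - binConv α q := by linarith
  unfold g
  positivity

/-- Inversion swaps the two fractions in `g`; for `F ≥ 1` the heavier weight `1 - α*q` sits on the
smaller one. -/
lemma g_inv_ge {α q F : ℝ} (hη : 1 ≤ eta α) (ha : binConv α q ≤ 1 / 2) (hF : 1 ≤ F) :
    g α q F ≤ g α q F⁻¹ := by
  have hη0 : 0 < eta α := by linarith
  have hF0 : 0 < F := by linarith
  have hA : eta α * F⁻¹ / (1 + eta α * F⁻¹) ^ 2 = F / eta α / (1 + F / eta α) ^ 2 := by
    field_simp
    ring
  have hB : F⁻¹ / eta α / (1 + F⁻¹ / eta α) ^ 2 = eta α * F / (1 + eta α * F) ^ 2 := by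
    field_simp
    ring
  have hAB : eta α * F / (1 + eta α * F) ^ 2 ≤ F / eta α / (1 + F / eta α) ^ 2 := by
    have : F / eta α / (1 + F / eta α) ^ 2 = eta α * F / (eta α + F) ^ 2 := by
      field_simp
    rw [this]
    refine div_le_div_of_nonneg_left (by positivity) (by positivity) ?_
    have : eta α + F ≤ 1 + eta α * F := by nlinarith
    gcongr
  unfold g
  rw [hA, hB]
  nlinarith

lemma hasDerivAt_g {α q F : ℝ} (hη : 0 < eta α) (ha0 : 0 < binConv α q) (hF : 0 < F) :
    HasDerivAt (g α q)
      (-(eta α * binConv α q * quartic α q F / ((1 + eta α * F) ^ 3 * (eta α + F) ^ 3))) F := by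
  have d1 : HasDerivAt (fun x : ℝ => eta α * x) (eta α) F := by
    simpa using (hasDerivAt_id F).const_mul (eta α)
  have d2 : HasDerivAt (fun x : ℝ => x / eta α) (1 / eta α) F :=
    (hasDerivAt_id F).div_const (eta α)
  have n1 : 1 + eta α * F ≠ 0 := by positivity
  have n2 : 1 + F / eta α ≠ 0 := by positivity
  have n3 : eta α + F ≠ 0 := by positivity
  have D := ((d1.fun_div ((d1.const_add 1).fun_pow 2) (pow_ne_zero 2 n1)).const_mul
    (1 - binConv α q)).fun_add ((d2.fun_div ((d2.const_add 1).fun_pow 2) (pow_ne_zero 2 n2)).const_mul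
    (binConv α q))
  refine D.congr_deriv ?_
  unfold quartic
  simp only [Nat.cast_ofNat, Nat.add_one_sub_one, pow_one]
  field_simp
  ring

lemma Fmax_sqrt_nonneg {α q : ℝ} (hη : 1 ≤ eta α) (hq0 : 0 < q) :
    0 ≤ 4 * eta α * q ^ 2 + (eta α - 1) ^ 2 * (1 - q) ^ 2 := by
  have : 0 ≤ eta α := by linarith
  positivity

/-- `F_max` is the fixed point of the odds recursion. -/
lemma Fmax_eq {α q : ℝ} (hη : 1 ≤ eta α) (hq0 : 0 < q) :
    eta α * q * Fmax α q ^ 2 = (eta α - 1) * (1 - q) * Fmax α q + q := by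
  have hη0 : 0 < eta α := by linarith
  have hs := Real.sq_sqrt (Fmax_sqrt_nonneg hη hq0)
  unfold Fmax
  set r := √(4 * eta α * q ^ 2 + (eta α - 1) ^ 2 * (1 - q) ^ 2)
  field_simp
  linear_combination hs

lemma one_le_Fmax {α q : ℝ} (hη : 1 ≤ eta α) (hq0 : 0 < q) (hq : q ≤ 1 / 2) :
    1 ≤ Fmax α q := by
  have hη0 : 0 < eta α := by linarith
  have hF0 : 0 < Fmax α q := by
    unfold Fmax
    have h1 : 0 < √(4 * eta α * q ^ 2 + (eta α - 1) ^ 2 * (1 - q) ^ 2) :=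
      Real.sqrt_pos.2 (by positivity)
    have h2 : 0 ≤ (eta α - 1) * (1 - q) := mul_nonneg (by linarith) (by linarith)
    positivity
  have e := Fmax_eq (α := α) hη hq0
  by_contra! hc
  have h3 : (eta α - 1) * q * Fmax α q ≤ (eta α - 1) * (1 - q) * Fmax α q := by
    refine mul_le_mul_of_nonneg_right (mul_le_mul_of_nonneg_left ?_ ?_) hF0.le <;> linarith
  have h4 : (1 - Fmax α q) * (eta α * Fmax α q + 1) * q > 0 :=
    mul_pos (mul_pos (by linarith) (by positivity)) hq0
  nlinarith

/-- The fixed-point equation reads `ηF (qF - (1-q)) = q - (1-q)F`, whose right side is nonpositive.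
-/
lemma q_mul_Fmax_le {α q : ℝ} (hη : 1 ≤ eta α) (hq0 : 0 < q) (hq : q ≤ 1 / 2) :
    q * Fmax α q ≤ 1 - q := by
  have hF := one_le_Fmax (α := α) hη hq0 hq
  have e := Fmax_eq (α := α) hη hq0
  by_contra! hc
  have h1 : (q * Fmax α q - (1 - q)) * (eta α * Fmax α q) > 0 :=
    mul_pos (by linarith) (by nlinarith)
  nlinarith

lemma exists_minimizer {α q : ℝ} (hα0 : 0 < α) (hα : α ≤ 1 / 2) (hq0 : 0 < q) (hq : q ≤ 1 / 2) :
    ∃ s ∈ candidates α q, IsMinOn (g α q) (Set.Icc 1 (Fmax α q)) s := by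
  have hη := one_le_eta hα0 hα
  have hη0 : 0 < eta α := by linarith
  have ha0 := binConv_pos hα0 hα hq0 hq
  have ha := binConv_le_half hα hq
  have hF := one_le_Fmax (α := α) hη hq0 hq
  obtain ⟨s, hs, hmin⟩ := isCompact_Icc.exists_isMinOn (Set.nonempty_Icc.2 hF)
    (f := g α q) fun x hx => (hasDerivAt_g hη0 ha0 (by linarith [hx.1])).continuousAt.continuousWithinAt
  refine ⟨s, ?_, hmin⟩
  rcases hs.2.eq_or_lt with h1 | h1
  · exact Or.inr h1
  refine Or.inl ⟨⟨hs.1, h1⟩, ?_⟩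
  have hs0 : 0 < s := by linarith [hs.1]
  -- The endpoint `s = 1` must also be a root. By `g_inv_ge`, `s` minimizes `g` on all of `(1/Fmax,
  -- Fmax)`, where `1` is interior.
  have hinv : (Fmax α q)⁻¹ < s :=
    lt_of_lt_of_le (inv_lt_one_of_one_lt₀ (by linarith [hs.1])) hs.1
  have hloc : IsLocalMin (g α q) s := by
    filter_upwards [Ioo_mem_nhds hinv h1] with x hx
    rcases le_total 1 x with h2 | h2
    · exact hmin ⟨h2, hx.2.le⟩
    · have hx0 : 0 < x := lt_trans (by positivity) hx.1
      have h3 : 1 ≤ x⁻¹ := (one_le_inv₀ hx0).2 h2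
      have h4 : x⁻¹ ≤ Fmax α q := inv_le_of_inv_le₀ (by linarith) hx.1.le
      have h5 := g_inv_ge (α := α) hη ha h3
      rw [inv_inv] at h5
      exact le_trans (hmin ⟨h3, h4⟩) h5
  have hd := hloc.hasDerivAt_eq_zero (hasDerivAt_g hη0 ha0 hs0)
  have n1 : (1 + eta α * s) ^ 3 * (eta α + s) ^ 3 ≠ 0 := by positivity
  rw [neg_eq_zero, div_eq_zero_iff, or_iff_left n1, mul_eq_zero] at hd
  exact hd.resolve_left (by positivity)

lemma candidates_subset {α q : ℝ} (hF : 1 ≤ Fmax α q) :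
    candidates α q ⊆ Set.Icc 1 (Fmax α q) := by
  rintro x (⟨hx, -⟩ | hx)
  · exact ⟨hx.1, hx.2.le⟩
  · rw [Set.mem_singleton_iff.1 hx]
    exact ⟨hF, le_rfl⟩

lemma exists_isFstar {α q : ℝ} (hα0 : 0 < α) (hα : α ≤ 1 / 2) (hq0 : 0 < q) (hq : q ≤ 1 / 2) :
    ∃ F, IsFstar α q F := by
  obtain ⟨s, hs, hmin⟩ := exists_minimizer hα0 hα hq0 hq
  exact ⟨s, hs, hmin.on_subset (candidates_subset (one_le_Fmax (one_le_eta hα0 hα) hq0 hq))⟩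

lemma IsFstar.isMinOn {α q F : ℝ} (hF : IsFstar α q F) (hα0 : 0 < α) (hα : α ≤ 1 / 2)
    (hq0 : 0 < q) (hq : q ≤ 1 / 2) : IsMinOn (g α q) (Set.Icc 1 (Fmax α q)) F := by
  obtain ⟨s, hs, hmin⟩ := exists_minimizer hα0 hα hq0 hq
  exact fun x hx => (isMinOn_iff.1 hF.2 s hs).trans (isMinOn_iff.1 hmin x hx)

/-! ### The filter recursion -/

/-- The `Bernoulli(p)` weight of a bit. -/
def bernoulliWeight (p : ℝ) (b : Bool) : ℝ := if b then p else 1 - p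

/-- A pair `v` holds the joint weights of a past with the current states `0` and `1`; observing
the output `c` multiplies them by the channel likelihoods. -/
def observe (α : ℝ) (c : Bool) (v : ℝ × ℝ) : ℝ × ℝ :=
  (bernoulliWeight α c * v.1, bernoulliWeight α (!c) * v.2)

/-- One step of the Markov chain. -/
def predict (q : ℝ) (v : ℝ × ℝ) : ℝ × ℝ :=
  ((1 - q) * v.1 + q * v.2, q * v.1 + (1 - q) * v.2)

def filterStep (α q : ℝ) (c : Bool) (v : ℝ × ℝ) : ℝ × ℝ := predict q (observe α c v)

/-- Summation of `φ` over the next output. -/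
def sumOutputs (α q : ℝ) (φ : ℝ × ℝ → ℝ) (v : ℝ × ℝ) : ℝ :=
  φ (filterStep α q false v) + φ (filterStep α q true v)

/-- The contribution of a past with weights `v` to the entropy. -/
def entropyTerm (v : ℝ × ℝ) : ℝ := -((v.1 + v.2) * Real.logb 2 (v.1 + v.2))

/-- The contribution of a past with weights `v` to the entropy increment. -/
def incrementTerm (α q : ℝ) (v : ℝ × ℝ) : ℝ := sumOutputs α q entropyTerm v - entropyTerm v

def stationary : ℝ × ℝ := (1 / 2, 1 / 2)

def positivePairs : Set (ℝ × ℝ) := {v | 0 < v.1 ∧ 0 < v.2}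

/-- The weights whose odds lie between `1 / F_max` and `F_max`. -/
def oddsCone (α q : ℝ) : Set (ℝ × ℝ) :=
  {v | 0 < v.1 ∧ 0 < v.2 ∧ v.1 ≤ Fmax α q * v.2 ∧ v.2 ≤ Fmax α q * v.1}

lemma filterStep_add (α q : ℝ) (c : Bool) (v w : ℝ × ℝ) :
    filterStep α q c (v + w) = filterStep α q c v + filterStep α q c w := by
  ext <;> simp [filterStep, predict, observe] <;> ring

lemma filterStep_stationary (α q : ℝ) :
    filterStep α q false stationary + filterStep α q true stationary = stationary := by
  ext <;> simp [filterStep, predict, observe, stationary, bernoulliWeight] <;> ring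

lemma bernoulliWeight_pos {p : ℝ} (h0 : 0 < p) (h1 : p < 1) (b : Bool) :
    0 < bernoulliWeight p b := by
  cases b <;> simp [bernoulliWeight, h0, h1]

lemma filterStep_pos {α q : ℝ} (hα0 : 0 < α) (hα : α < 1) (hq0 : 0 < q) (hq : q < 1) (c : Bool)
    {v : ℝ × ℝ} (hv : v ∈ positivePairs) : filterStep α q c v ∈ positivePairs := by
  obtain ⟨h1, h2⟩ := hv
  have a := bernoulliWeight_pos hα0 hα c
  have b := bernoulliWeight_pos hα0 hα (!c)
  have : 0 < 1 - q := by linarith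
  constructor <;> simp only [filterStep, predict, observe] <;> positivity

/-- An observation changes the odds by a factor of at most `η` either way, and prediction, monotone
in the odds, sends odds `η Fmax` exactly to `Fmax`. -/
lemma filterStep_mem_oddsCone {α q : ℝ} (hα0 : 0 < α) (hα : α ≤ 1 / 2) (hq0 : 0 < q)
    (hq : q ≤ 1 / 2) (c : Bool) {v : ℝ × ℝ} (hv : v ∈ oddsCone α q) :
    filterStep α q c v ∈ oddsCone α q := by
  obtain ⟨h1, h2, h3, h4⟩ := hv
  have hη := one_le_eta hα0 hα
  have e := Fmax_eq (α := α) hη hq0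
  have hF := one_le_Fmax (α := α) hη hq0 hq
  have hqF := q_mul_Fmax_le (α := α) hη hq0 hq
  obtain ⟨p1, p2⟩ := filterStep_pos hα0 (by linarith) hq0 (by linarith) c ⟨h1, h2⟩
  set F := Fmax α q
  have hα1 : 1 - α = eta α * α := by
    unfold eta
    field_simp
  have key : ∀ x y : ℝ, 0 < x → 0 < y → x ≤ eta α * F * y →
      (1 - q) * x + q * y ≤ F * (q * x + (1 - q) * y) := by
    intro x y hx hy hxy
    have : (1 - q - q * F) * x ≤ (1 - q - q * F) * (eta α * F * y) :=
      mul_le_mul_of_nonneg_left hxy (by linarith)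
    have e2 : (1 - q - q * F) * (eta α * F * y) = ((1 - q) * F - q) * y := by
      linear_combination (-y) * e
    linarith
  have bound : ∀ a b x y : ℝ, 0 < a → 0 < b → 0 < x → 0 < y → a ≤ eta α * b → x ≤ F * y →
      a * x ≤ eta α * F * (b * y) := by
    intro a b x y ha hb hx hy hab hxy
    calc a * x ≤ eta α * b * (F * y) := mul_le_mul hab hxy hx.le (by nlinarith)
      _ = _ := by ring
  have w : ∀ c, bernoulliWeight α c ≤ eta α * bernoulliWeight α (!c) := by
    rintro (_ | _) <;> simp only [bernoulliWeight, Bool.not_false, Bool.not_true, if_true,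
      Bool.false_eq_true, if_false]
    · exact hα1.le
    · nlinarith
  have a := bernoulliWeight_pos hα0 (by linarith) c
  have b := bernoulliWeight_pos hα0 (by linarith) (!c)
  have w2 := w (!c)
  rw [Bool.not_not] at w2
  refine ⟨p1, p2, ?_, ?_⟩ <;> simp only [filterStep, predict, observe]
  · exact key _ _ (by positivity) (by positivity) (bound _ _ _ _ a b h1 h2 (w c) h3)
  · have := key _ _ (by positivity) (by positivity) (bound _ _ _ _ b a h2 h1 w2 h4)
    linarith

/-! ### Entropy increments -/

/-- The sum of the two components is preserved by summation over the outputs. -/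
lemma filterStep_mass (α q : ℝ) (v : ℝ × ℝ) :
    ((filterStep α q false v).1 + (filterStep α q false v).2)
      + ((filterStep α q true v).1 + (filterStep α q true v).2) = v.1 + v.2 := by
  simp [filterStep, predict, observe, bernoulliWeight]
  ring

lemma sumOutputs_mono_on {α q : ℝ} {S : Set (ℝ × ℝ)}
    (hS : ∀ c, ∀ v ∈ S, filterStep α q c v ∈ S) {φ ψ : ℝ × ℝ → ℝ} (h : ∀ v ∈ S, φ v ≤ ψ v)
    (n : ℕ) : ∀ v ∈ S, (sumOutputs α q)^[n] φ v ≤ (sumOutputs α q)^[n] ψ v := by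
  induction n with
  | zero => exact h
  | succ n ih =>
    intro v hv
    rw [Function.iterate_succ_apply', Function.iterate_succ_apply']
    exact add_le_add (ih _ (hS _ v hv)) (ih _ (hS _ v hv))

lemma sumOutputs_iterate_mass (α q r : ℝ) (n : ℕ) (v : ℝ × ℝ) :
    (sumOutputs α q)^[n] (fun w => r * (w.1 + w.2)) v = r * (v.1 + v.2) := by
  induction n generalizing v with
  | zero => rfl
  | succ n ih =>
    rw [Function.iterate_succ_apply', sumOutputs, ih, ih, ← mul_add, filterStep_mass]

lemma sumOutputs_iterate_sub (α q : ℝ) (φ ψ : ℝ × ℝ → ℝ) (n : ℕ) (v : ℝ × ℝ) :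
    (sumOutputs α q)^[n] (fun w => φ w - ψ w) v
      = (sumOutputs α q)^[n] φ v - (sumOutputs α q)^[n] ψ v := by
  induction n generalizing v with
  | zero => rfl
  | succ n ih =>
    simp only [Function.iterate_succ_apply', sumOutputs, ih]
    ring

lemma sumOutputs_iterate_superadditive {α q : ℝ} (hα0 : 0 < α) (hα : α < 1) (hq0 : 0 < q)
    (hq : q < 1) {φ : ℝ × ℝ → ℝ}
    (h : ∀ v ∈ positivePairs, ∀ w ∈ positivePairs, φ v + φ w ≤ φ (v + w)) (n : ℕ) :
    ∀ v ∈ positivePairs, ∀ w ∈ positivePairs,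
      (sumOutputs α q)^[n] φ v + (sumOutputs α q)^[n] φ w ≤ (sumOutputs α q)^[n] φ (v + w) := by
  induction n with
  | zero => exact h
  | succ n ih =>
    intro v hv w hw
    simp only [Function.iterate_succ_apply', sumOutputs, filterStep_add]
    have h1 := ih _ (filterStep_pos hα0 hα hq0 hq false hv) _ (filterStep_pos hα0 hα hq0 hq false hw)
    have h2 := ih _ (filterStep_pos hα0 hα hq0 hq true hv) _ (filterStep_pos hα0 hα hq0 hq true hw)
    linarith

/-- The unnormalized entropy of a two-point distribution. -/
def pairEntropy (a b : ℝ) : ℝ :=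
  (a + b) * Real.logb 2 (a + b) - a * Real.logb 2 a - b * Real.logb 2 b

lemma incrementTerm_eq (α q : ℝ) (v : ℝ × ℝ) :
    incrementTerm α q v = pairEntropy ((filterStep α q false v).1 + (filterStep α q false v).2)
      ((filterStep α q true v).1 + (filterStep α q true v).2) := by
  rw [incrementTerm, sumOutputs, pairEntropy, filterStep_mass]
  simp only [entropyTerm]
  ring

lemma pairEntropy_eq {a b : ℝ} (ha : 0 < a) (hb : 0 < b) :
    pairEntropy a b = (a + b) * h (b / (a + b)) := by
  have hab : a + b ≠ 0 := by positivity
  have e : 1 - b / (a + b) = a / (a + b) := by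
    field_simp
    ring
  rw [h, e, Real.logb_div hb.ne' hab, Real.logb_div ha.ne' hab, pairEntropy]
  field_simp
  ring

lemma pairEntropy_superadditive {a b c d : ℝ} (ha : 0 < a) (hb : 0 < b) (hc : 0 < c)
    (hd : 0 < d) : pairEntropy a b + pairEntropy c d ≤ pairEntropy (a + c) (b + d) := by
  -- Gibbs' inequality termwise, comparing the proportion `x/s` with `y/t`. In the sum of the four
  -- instances below the linear terms cancel, by `e`.
  have gibbs : ∀ x s y t : ℝ, 0 < x → 0 < s → 0 < y → 0 < t →
      x - y * s / t ≤ x * (Real.log x - Real.log s - (Real.log y - Real.log t)) := by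
    intro x s y t hx hs hy ht
    have h1 := Real.log_le_sub_one_of_pos (x := y * s / (t * x)) (by positivity)
    rw [Real.log_div (by positivity) (by positivity), Real.log_mul hy.ne' hs.ne',
      Real.log_mul ht.ne' hx.ne'] at h1
    have h2 := mul_le_mul_of_nonneg_left h1 hx.le
    have e : x * (y * s / (t * x) - 1) = y * s / t - x := by
      field_simp
    rw [e] at h2
    linarith
  have t : (0 : ℝ) < a + c + (b + d) := by positivity
  have g1 := gibbs a (a + b) (a + c) _ ha (by positivity) (by positivity) t
  have g2 := gibbs b (a + b) (b + d) _ hb (by positivity) (by positivity) t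
  have g3 := gibbs c (c + d) (a + c) _ hc (by positivity) (by positivity) t
  have g4 := gibbs d (c + d) (b + d) _ hd (by positivity) (by positivity) t
  have e : (a + c) * (a + b) / (a + c + (b + d)) + (b + d) * (a + b) / (a + c + (b + d))
      + (a + c) * (c + d) / (a + c + (b + d)) + (b + d) * (c + d) / (a + c + (b + d))
      = a + b + c + d := by
    field_simp
    ring
  have hl := Real.log_pos one_lt_two
  unfold pairEntropy Real.logb
  rw [← sub_nonneg]
  refine (div_nonneg (?_ : 0 ≤ (a + c + (b + d)) * Real.log (a + c + (b + d))
    - (a + c) * Real.log (a + c) - (b + d) * Real.log (b + d)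
    - ((a + b) * Real.log (a + b) - a * Real.log a - b * Real.log b
      + ((c + d) * Real.log (c + d) - c * Real.log c - d * Real.log d))) hl.le).trans_eq ?_
  · linarith
  · field_simp

lemma incrementTerm_superadditive {α q : ℝ} (hα0 : 0 < α) (hα : α < 1) (hq0 : 0 < q) (hq : q < 1) :
    ∀ v ∈ positivePairs, ∀ w ∈ positivePairs,
      incrementTerm α q v + incrementTerm α q w ≤ incrementTerm α q (v + w) := by
  intro v hv w hw
  have p : ∀ c, ∀ u ∈ positivePairs, 0 < (filterStep α q c u).1 + (filterStep α q c u).2 :=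
    fun c u hu => add_pos (filterStep_pos hα0 hα hq0 hq c hu).1 (filterStep_pos hα0 hα hq0 hq c hu).2
  have := pairEntropy_superadditive (p false v hv) (p true v hv) (p false w hw) (p true w hw)
  simp only [incrementTerm_eq, filterStep_add, Prod.fst_add, Prod.snd_add]
  convert this using 2 <;> ring

lemma stationary_pos : stationary ∈ positivePairs := by
  constructor <;> norm_num [stationary]

/-- Conditioning on one more, earlier output cannot raise the entropy: the first output splits
`stationary` into two pairs that sum to it, and superadditivity applies. -/
lemma increment_antitone {α q : ℝ} (hα0 : 0 < α) (hα : α < 1) (hq0 : 0 < q) (hq : q < 1) :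
    Antitone fun n => (sumOutputs α q)^[n] (incrementTerm α q) stationary := by
  refine antitone_nat_of_succ_le fun n => ?_
  rw [Function.iterate_succ_apply', sumOutputs]
  refine (sumOutputs_iterate_superadditive hα0 hα hq0 hq
    (incrementTerm_superadditive hα0 hα hq0 hq) n _
    (filterStep_pos hα0 hα hq0 hq _ stationary_pos) _
    (filterStep_pos hα0 hα hq0 hq _ stationary_pos)).trans_eq ?_
  rw [filterStep_stationary]

lemma sum_increment (α q : ℝ) (n : ℕ) :
    ∑ i ∈ Finset.range n, (sumOutputs α q)^[i] (incrementTerm α q) stationary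
      = (sumOutputs α q)^[n] entropyTerm stationary := by
  have h0 : entropyTerm stationary = 0 := by norm_num [entropyTerm, stationary]
  have : ∀ i, (sumOutputs α q)^[i] (incrementTerm α q) stationary
      = (sumOutputs α q)^[i + 1] entropyTerm stationary
        - (sumOutputs α q)^[i] entropyTerm stationary := fun i => by
    rw [Function.iterate_succ_apply, ← sumOutputs_iterate_sub]
    rfl
  rw [Finset.sum_congr rfl fun i _ => this i,
    Finset.sum_range_sub fun i => (sumOutputs α q)^[i] entropyTerm stationary]
  simp [h0]

/-! ### The lower bound for the increments -/

/-- Here `u` holds the weights after an observation and before the transition, so the flip and the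
channel noise act together as one convolution by `α*q`. -/
lemma incrementTerm_predict_ge {α q : ℝ} (hα0 : 0 < α) (hα : α ≤ 1 / 2) (hq0 : 0 < q)
    (hq : q ≤ 1 / 2) {u : ℝ × ℝ} (hu : u ∈ positivePairs) :
    (u.1 + u.2) * h (binConv α q) + (1 - h (binConv α q)) * (4 * (u.1 * u.2 / (u.1 + u.2)))
      ≤ incrementTerm α q (predict q u) := by
  obtain ⟨h1, h2⟩ := hu
  have hs : 0 < u.1 + u.2 := by positivity
  have hpu : predict q u ∈ positivePairs := by
    have : 0 < 1 - q := by linarith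
    constructor <;> simp only [predict] <;> positivity
  have p : ∀ c, 0 < (filterStep α q c (predict q u)).1 + (filterStep α q c (predict q u)).2 :=
    fun c => have := filterStep_pos hα0 (by linarith) hq0 (by linarith) c hpu
      add_pos this.1 this.2
  have hm : (predict q u).1 + (predict q u).2 = u.1 + u.2 := by
    simp only [predict]
    ring
  have hb : ((filterStep α q true (predict q u)).1 + (filterStep α q true (predict q u)).2)
      / (u.1 + u.2) = binConv (binConv α q) (u.2 / (u.1 + u.2)) := by
    simp [filterStep, predict, observe, bernoulliWeight, binConv]
    field_simp
    ring
  have hx : u.2 / (u.1 + u.2) ≤ 1 := (div_le_one hs).2 (by linarith)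
  have key := mul_le_mul_of_nonneg_left (h_binConv_ge (binConv_pos hα0 hα hq0 hq)
    (lt_of_le_of_lt (binConv_le_half hα hq) one_half_lt_one) (by positivity) hx) hs.le
  rw [incrementTerm_eq, pairEntropy_eq (p false) (p true), filterStep_mass, hm, hb]
  refine le_trans (le_of_eq ?_) key
  field_simp
  ring

/-- `P` and `Q` are the masses of the outputs `1` and `0`. Both sides average the posterior values
`α(1-α)xy/P²` and `α(1-α)xy/Q²`, the right with the true weights `P`, `Q`, the left with `1 - α*q`,
`α*q`. The latter put more weight on the smaller value. -/
lemma product_sum_ge_of_le {α q x y : ℝ} (hα0 : 0 < α) (hα : α ≤ 1 / 2) (hq0 : 0 < q)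
    (hq : q ≤ 1 / 2) (hx : 0 < x) (hxy : x ≤ y) (hy : y ≤ Fmax α q * x) :
    (x + y) * g α q (y / x) ≤
      (1 - α) * x * (α * y) / ((1 - α) * x + α * y)
        + α * x * ((1 - α) * y) / (α * x + (1 - α) * y) := by
  have hy0 : 0 < y := by linarith
  have hα1 : 0 < 1 - α := by linarith
  have hqF := q_mul_Fmax_le (one_le_eta hα0 hα) hq0 hq
  have hqy : q * y ≤ (1 - q) * x := by
    calc q * y ≤ q * (Fmax α q * x) := by gcongr
      _ = q * Fmax α q * x := by ring
      _ ≤ _ := by gcongr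
  set P := α * x + (1 - α) * y with hP
  set Q := (1 - α) * x + α * y with hQ
  have hP0 : 0 < P := by positivity
  have hQ0 : 0 < Q := by positivity
  have hQP : Q ≤ P := by nlinarith
  have hPQ : P + Q = x + y := by rw [hP, hQ]; ring
  -- The gap is `(1 - 2α)((1-q)x - qy)`.
  have hPa : P ≤ (1 - binConv α q) * (P + Q) := by
    rw [hPQ, hP, binConv]
    nlinarith
  have hg : g α q (y / x) = α * (1 - α) * x * y *
      ((1 - binConv α q) / P ^ 2 + binConv α q / Q ^ 2) := by
    have e1 : eta α * (y / x) / (1 + eta α * (y / x)) ^ 2 = α * (1 - α) * x * y / P ^ 2 := by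
      have : 1 + eta α * (y / x) = P / (α * x) := by
        rw [eta, hP]
        field_simp
      rw [this, eta]
      field_simp
    have e2 : y / x / eta α / (1 + y / x / eta α) ^ 2 = α * (1 - α) * x * y / Q ^ 2 := by
      have : 1 + y / x / eta α = Q / ((1 - α) * x) := by
        rw [eta, hQ]
        field_simp
      rw [this, eta]
      field_simp
    rw [g, e1, e2]
    ring
  rw [hg, ← hPQ]
  have main : (P + Q) * ((1 - binConv α q) / P ^ 2 + binConv α q / Q ^ 2) ≤ 1 / Q + 1 / P := by
    have e : 1 / Q + 1 / P - (P + Q) * ((1 - binConv α q) / P ^ 2 + binConv α q / Q ^ 2)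
        = ((1 - binConv α q) * (P + Q) - P) * (P - Q) * (P + Q) / (P ^ 2 * Q ^ 2) := by
      field_simp
      ring
    have : 0 ≤ ((1 - binConv α q) * (P + Q) - P) * (P - Q) * (P + Q) / (P ^ 2 * Q ^ 2) := by
      have h1 : 0 ≤ (1 - binConv α q) * (P + Q) - P := by linarith
      have h2 : 0 ≤ P - Q := by linarith
      positivity
    linarith
  have := mul_le_mul_of_nonneg_left main (show 0 ≤ α * (1 - α) * x * y by positivity)
  calc _ = _ := by ring
    _ ≤ _ := this
    _ = _ := by ring

lemma sumOutputs_incrementTerm_ge {α q F : ℝ} (hα0 : 0 < α) (hα : α ≤ 1 / 2) (hq0 : 0 < q)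
    (hq : q ≤ 1 / 2) (hF : IsMinOn (g α q) (Set.Icc 1 (Fmax α q)) F) {v : ℝ × ℝ}
    (hv : v ∈ oddsCone α q) :
    (h (binConv α q) + (1 - h (binConv α q)) * (4 * g α q F)) * (v.1 + v.2)
      ≤ sumOutputs α q (incrementTerm α q) v := by
  obtain ⟨h1, h2, h3, h4⟩ := hv
  have hα1 : 0 < 1 - α := by linarith
  have hpos : ∀ c, observe α c v ∈ positivePairs := fun c =>
    ⟨mul_pos (bernoulliWeight_pos hα0 (by linarith) c) h1,
      mul_pos (bernoulliWeight_pos hα0 (by linarith) (!c)) h2⟩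
  have key : (v.1 + v.2) * g α q F ≤
      (1 - α) * v.1 * (α * v.2) / ((1 - α) * v.1 + α * v.2)
        + α * v.1 * ((1 - α) * v.2) / (α * v.1 + (1 - α) * v.2) := by
    rcases le_total v.1 v.2 with hle | hle
    · refine le_trans ?_ (product_sum_ge_of_le hα0 hα hq0 hq h1 hle h4)
      gcongr
      exact isMinOn_iff.1 hF _ ⟨(one_le_div h1).2 hle, (div_le_iff₀ h1).2 h4⟩
    · have := product_sum_ge_of_le hα0 hα hq0 hq h2 hle h3
      calc (v.1 + v.2) * g α q F ≤ (v.1 + v.2) * g α q (v.1 / v.2) := by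
            gcongr
            exact isMinOn_iff.1 hF _ ⟨(one_le_div h2).2 hle, (div_le_iff₀ h2).2 h3⟩
        _ = (v.2 + v.1) * g α q (v.1 / v.2) := by rw [add_comm]
        _ ≤ _ := this
        _ = _ := by
          rw [add_comm, add_comm (α * v.2), add_comm ((1 - α) * v.2)]
          ring
  have hh : 0 ≤ 1 - h (binConv α q) := sub_nonneg.2 (h_le_one (binConv_pos hα0 hα hq0 hq)
    (lt_of_le_of_lt (binConv_le_half hα hq) one_half_lt_one))
  have b0 := incrementTerm_predict_ge hα0 hα hq0 hq (hpos false)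
  have b1 := incrementTerm_predict_ge hα0 hα hq0 hq (hpos true)
  have k := mul_le_mul_of_nonneg_left key hh
  simp only [observe, bernoulliWeight, Bool.not_false, Bool.not_true, if_true,
    Bool.false_eq_true, if_false] at b0 b1
  simp only [sumOutputs, filterStep, observe, bernoulliWeight, Bool.not_false, Bool.not_true,
    if_true, Bool.false_eq_true, if_false]
  linarith

lemma stationary_mem_oddsCone {α q : ℝ} (hF : 1 ≤ Fmax α q) : stationary ∈ oddsCone α q := by
  refine ⟨?_, ?_, ?_, ?_⟩ <;> simp only [stationary] <;> linarith

/-- The shift to `n + 1` appears because the bound averages over an observation made before the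
output being counted. -/
lemma increment_succ_ge {α q F : ℝ} (hα0 : 0 < α) (hα : α ≤ 1 / 2) (hq0 : 0 < q)
    (hq : q ≤ 1 / 2) (hF : IsMinOn (g α q) (Set.Icc 1 (Fmax α q)) F) (n : ℕ) :
    h (binConv α q) + (1 - h (binConv α q)) * (4 * g α q F)
      ≤ (sumOutputs α q)^[n + 1] (incrementTerm α q) stationary := by
  have := sumOutputs_mono_on (S := oddsCone α q)
    (fun c v hv => filterStep_mem_oddsCone hα0 hα hq0 hq c hv)
    (fun v hv => sumOutputs_incrementTerm_ge hα0 hα hq0 hq hF hv) n stationary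
    (stationary_mem_oddsCone (one_le_Fmax (one_le_eta hα0 hα) hq0 hq))
  rw [sumOutputs_iterate_mass] at this
  rw [Function.iterate_succ_apply]
  refine le_trans (le_of_eq ?_) this
  norm_num [stationary]

/-- The entropy per output converges, to a limit that satisfies the lower bound. -/
lemma exists_tendsto_entropy {α q : ℝ} (hα0 : 0 < α) (hα : α ≤ 1 / 2) (hq0 : 0 < q)
    (hq : q ≤ 1 / 2) :
    ∃ H : ℝ, Tendsto (fun n : ℕ => (sumOutputs α q)^[n] entropyTerm stationary / n) atTop (𝓝 H) ∧
      ∀ F, IsMinOn (g α q) (Set.Icc 1 (Fmax α q)) F →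
        h (binConv α q) + (1 - h (binConv α q)) * (4 * g α q F) ≤ H := by
  have anti := increment_antitone hα0 (by linarith) hq0 (by linarith : q < 1)
  obtain ⟨s, -, hs⟩ := exists_minimizer hα0 hα hq0 hq
  have bdd : BddBelow (Set.range fun n =>
      (sumOutputs α q)^[n] (incrementTerm α q) stationary) := by
    refine ⟨h (binConv α q) + (1 - h (binConv α q)) * (4 * g α q s), ?_⟩
    rintro _ ⟨n, rfl⟩
    exact (increment_succ_ge hα0 hα hq0 hq hs n).trans (anti n.le_succ)
  have lim := tendsto_atTop_ciInf anti bdd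
  refine ⟨_, ?_, fun F hF => ge_of_tendsto ((tendsto_add_atTop_iff_nat 1).2 lim)
    (Eventually.of_forall fun n => increment_succ_ge hα0 hα hq0 hq hF n)⟩
  refine lim.cesaro.congr fun n => ?_
  rw [sum_increment, div_eq_inv_mul]

/-! ### Independence of the next innovations from the past -/

lemma indepFun_prodMk_prodMk {Ω A B C D : Type*} [MeasurableSpace Ω] {μ : Measure Ω}
    [IsProbabilityMeasure μ] [MeasurableSpace A] [MeasurableSpace B] [MeasurableSpace C]
    [MeasurableSpace D] [Countable A] [Countable B] [Countable C] [Countable D]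
    [MeasurableSingletonClass A] [MeasurableSingletonClass B] [MeasurableSingletonClass C]
    [MeasurableSingletonClass D] {U₁ : Ω → A} {V₁ : Ω → B} {U₂ : Ω → C} {V₂ : Ω → D}
    (mU₁ : Measurable U₁) (mV₁ : Measurable V₁) (mU₂ : Measurable U₂) (mV₂ : Measurable V₂)
    (h₁ : IndepFun U₁ V₁ μ) (h₂ : IndepFun U₂ V₂ μ)
    (h : IndepFun (fun ω => (U₁ ω, V₁ ω)) (fun ω => (U₂ ω, V₂ ω)) μ) :
    IndepFun (fun ω => (U₁ ω, U₂ ω)) (fun ω => (V₁ ω, V₂ ω)) μ := by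
  have hU : IndepFun U₁ U₂ μ := h.comp measurable_fst measurable_fst
  have hV : IndepFun V₁ V₂ μ := h.comp measurable_snd measurable_snd
  rw [indepFun_iff_map_prod_eq_prod_map_map (by fun_prop) (by fun_prop)]
  refine Measure.ext_of_singleton fun ⟨⟨a, c⟩, b, d⟩ => ?_
  have sA : MeasurableSet ({a} : Set A) := measurableSet_singleton a
  have sB : MeasurableSet ({b} : Set B) := measurableSet_singleton b
  have sC : MeasurableSet ({c} : Set C) := measurableSet_singleton c
  have sD : MeasurableSet ({d} : Set D) := measurableSet_singleton d
  have e₁ := h₁.measure_inter_preimage_eq_mul _ _ sA sB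
  have e₂ := h₂.measure_inter_preimage_eq_mul _ _ sC sD
  have e := h.measure_inter_preimage_eq_mul _ _ (sA.prod sB) (sC.prod sD)
  have eU := hU.measure_inter_preimage_eq_mul _ _ sA sC
  have eV := hV.measure_inter_preimage_eq_mul _ _ sB sD
  rw [← Set.singleton_prod_singleton, Measure.prod_prod, ← Set.singleton_prod_singleton,
    ← Set.singleton_prod_singleton, Measure.map_apply (by fun_prop) ((sA.prod sC).prod (sB.prod sD)),
    Measure.map_apply (by fun_prop) (sA.prod sC), Measure.map_apply (by fun_prop) (sB.prod sD)]
  simp only [Set.mk_preimage_prod] at e ⊢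
  rw [eU, eV, Set.inter_inter_inter_comm, e, e₁, e₂]
  ring

/-! ### The law of the output pasts and the filter recursion. -/

section Innovations

variable {Ω : Type*} [MeasurableSpace Ω] {μ : Measure Ω}

/-- The event that the first outputs are `s` and the next state is `b`. -/
def pastEvent (X Y : ℕ → Ω → Bool) {n : ℕ} (s : Fin n → Bool) (b : Bool) : Set Ω :=
  {ω | (∀ i : Fin n, Y i ω = s i) ∧ X n ω = b}

/-- The probabilities of `pastEvent` for the two possible next states. -/
def pastWeights (μ : Measure Ω) (X Y : ℕ → Ω → Bool) {n : ℕ} (s : Fin n → Bool) : ℝ × ℝ :=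
  (μ.real (pastEvent X Y s false), μ.real (pastEvent X Y s true))

lemma measurableSet_pastEvent {X Y : ℕ → Ω → Bool} (mX : ∀ n, Measurable (X n))
    (mY : ∀ n, Measurable (Y n)) {n : ℕ} (s : Fin n → Bool) (b : Bool) :
    MeasurableSet (pastEvent X Y s b) := by
  refine MeasurableSet.inter ?_ (mX n (measurableSet_singleton b))
  have : {ω | ∀ i : Fin n, Y i ω = s i} = ⋂ i : Fin n, Y i ⁻¹' {s i} := by
    ext ω
    simp
  change MeasurableSet {ω | ∀ i : Fin n, Y i ω = s i}
  rw [this]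
  exact MeasurableSet.iInter fun i => mY i (measurableSet_singleton _)

lemma sum_pastWeights {X Y : ℕ → Ω → Bool} {α q : ℝ}
    (h0 : ∀ b, μ.real (X 0 ⁻¹' {b}) = 1 / 2)
    (hsnoc : ∀ n (s : Fin n → Bool) (c : Bool),
      pastWeights μ X Y (Fin.snoc s c : Fin (n + 1) → Bool)
        = filterStep α q c (pastWeights μ X Y s)) (n : ℕ) (φ : ℝ × ℝ → ℝ) :
    ∑ s : Fin n → Bool, φ (pastWeights μ X Y s) = (sumOutputs α q)^[n] φ stationary := by
  induction n generalizing φ with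
  | zero =>
    have : ∀ s : Fin 0 → Bool, pastWeights μ X Y s = stationary := by
      intro s
      have e : ∀ b, pastEvent X Y s b = X 0 ⁻¹' {b} := fun b => by
        ext ω
        simp [pastEvent]
      simp [pastWeights, e, h0, stationary]
    simp [this]
  | succ n ih =>
    -- This unfolding peels off the last output, in agreement with `Fin.snoc`.
    rw [Function.iterate_succ_apply, ← ih,
      ← (Fin.snocEquiv fun _ : Fin (n + 1) => Bool).sum_comp, Fintype.sum_prod_type_right]
    refine Finset.sum_congr rfl fun s _ => ?_
    rw [Fintype.sum_bool, add_comm]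
    exact congrArg₂ (· + ·) (congrArg φ (hsnoc n s false)) (congrArg φ (hsnoc n s true))

lemma IsBernoulliProcess.indepFun_past {B : ℕ → Ω → Bool} {p : ℝ} (hB : IsBernoulliProcess μ B p)
    (n : ℕ) : IndepFun (fun ω (i : Fin n) => B i ω) (B n) μ := by
  have h := hB.indep.indepFun_finset (Finset.range n) {n} (by simp) hB.measurable
  exact h.comp (φ := fun f (i : Fin n) => f ⟨i, Finset.mem_range.2 i.2⟩)
    (ψ := fun f : ({n} : Finset ℕ) → Bool => f ⟨n, Finset.mem_singleton_self n⟩)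
    (by fun_prop) Measurable.of_discrete

variable [IsProbabilityMeasure μ]

lemma IsBernoulliProcess.measureReal_eq {B : ℕ → Ω → Bool} {p : ℝ} (hB : IsBernoulliProcess μ B p)
    (n : ℕ) (b : Bool) : μ.real (B n ⁻¹' {b}) = bernoulliWeight p b := by
  have ht : μ.real (B n ⁻¹' {true}) = p := hB.prob n
  cases b
  · have : B n ⁻¹' {false} = (B n ⁻¹' {true})ᶜ := by
      ext ω
      simp
    rw [this, probReal_compl_eq_one_sub (hB.measurable n (measurableSet_singleton _)), ht]
    rfl
  · exact ht

/-- The path that starts at `x` and is flipped according to `w`. -/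
def flipPath (x : Bool) (w : ℕ → Bool) : ℕ → Bool
  | 0 => x
  | n + 1 => xor (flipPath x w n) (w n)

lemma indepFun_path {X W : ℕ → Ω → Bool} {q : ℝ} (hX0 : Measurable (X 0))
    (hW : IsBernoulliProcess μ W q) (hXW : IndepFun (X 0) (fun ω m => W m ω) μ)
    (hstep : ∀ m ω, X (m + 1) ω = xor (X m ω) (W m ω)) (n : ℕ) :
    IndepFun (fun ω (i : Fin (n + 1)) => X i ω) (W n) μ := by
  have mW : ∀ n, Measurable (W n) := hW.measurable
  -- The initial bit has no innovation of its own, so a unit value fills that slot in the regrouping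
  -- lemma.
  have h : IndepFun (fun ω => (X 0 ω, fun i : Fin n => W i ω)) (fun ω => ((), W n ω)) μ := by
    refine indepFun_prodMk_prodMk hX0 measurable_const
      (measurable_pi_lambda _ fun i => mW i) (mW n) (indepFun_const_right _ _) (hW.indepFun_past n) ?_
    exact hXW.comp (φ := fun x => (x, ())) (ψ := fun w => (fun i : Fin n => w i, w n))
      (by fun_prop) (by fun_prop)
  -- The path up to time `n` reads only the flips before `n`; the default `false` is never used.
  have h' := h.comp
    (φ := fun (p : Bool × (Fin n → Bool)) (i : Fin (n + 1)) =>
      flipPath p.1 (fun j => if hj : j < n then p.2 ⟨j, hj⟩ else false) i)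
    (ψ := Prod.snd) Measurable.of_discrete measurable_snd
  have e : ∀ ω, ∀ i ≤ n, X i ω
      = flipPath (X 0 ω) (fun j => if j < n then W j ω else false) i := by
    intro ω i
    induction i with
    | zero => intro _; rfl
    | succ i ih =>
      intro hi
      rw [hstep, ih (by omega), flipPath, if_pos (by omega : i < n)]
  have hX : (fun ω (i : Fin (n + 1)) => X i ω)
      = (fun (p : Bool × (Fin n → Bool)) (i : Fin (n + 1)) =>
        flipPath p.1 (fun j => if hj : j < n then p.2 ⟨j, hj⟩ else false) i) ∘
        fun ω => (X 0 ω, fun i : Fin n => W i ω) := by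
    ext ω i
    simpa using e ω i (by omega)
  rw [hX]
  exact h'

lemma indepFun_innovation {X W Z : ℕ → Ω → Bool} {α q : ℝ} (hX0 : Measurable (X 0))
    (hW : IsBernoulliProcess μ W q) (hXW : IndepFun (X 0) (fun ω m => W m ω) μ)
    (hstep : ∀ m ω, X (m + 1) ω = xor (X m ω) (W m ω)) (hZ : IsBernoulliProcess μ Z α)
    (hXZ : IndepFun (fun ω n => X n ω) (fun ω n => Z n ω) μ) (n : ℕ) :
    IndepFun (fun ω => (fun i : Fin (n + 1) => X i ω, fun i : Fin n => Z i ω))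
      (fun ω => (W n ω, Z n ω)) μ := by
  have mW : ∀ n, Measurable (W n) := hW.measurable
  have mZ : ∀ n, Measurable (Z n) := hZ.measurable
  have mX : ∀ n, Measurable (X n) := by
    intro n
    induction n with
    | zero => exact hX0
    | succ n ih =>
      have : X (n + 1) = (fun p : Bool × Bool => xor p.1 p.2) ∘ fun ω => (X n ω, W n ω) :=
        funext (hstep n)
      rw [this]
      exact Measurable.of_discrete.comp (ih.prodMk (mW n))
  refine indepFun_prodMk_prodMk (measurable_pi_lambda _ fun i => mX i) (mW n)
    (measurable_pi_lambda _ fun i => mZ i) (mZ n) (indepFun_path hX0 hW hXW hstep n)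
    (hZ.indepFun_past n) ?_
  -- `W n` is recovered as `X n xor X (n + 1)`, so independence of `X` and `Z` also covers the flip.
  have hp : Measurable fun x : ℕ → Bool => (x n, x (n + 1)) := by fun_prop
  have hx : Measurable fun x : ℕ → Bool => xor (x n) (x (n + 1)) :=
    (Measurable.of_discrete (f := fun p : Bool × Bool => xor p.1 p.2)).comp hp
  have h := hXZ.comp (φ := fun x => (fun i : Fin (n + 1) => x i, xor (x n) (x (n + 1))))
    (ψ := fun z => (fun i : Fin n => z i, z n))
    (Measurable.prodMk (by fun_prop) hx) (by fun_prop)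
  convert h using 1
  · ext ω : 1
    simp [hstep]
  · rfl

lemma pastWeights_snoc {X W Z Y : ℕ → Ω → Bool} {α q : ℝ} (mX : ∀ n, Measurable (X n))
    (mY : ∀ n, Measurable (Y n)) (hW : IsBernoulliProcess μ W q)
    (hstep : ∀ m ω, X (m + 1) ω = xor (X m ω) (W m ω)) (hZ : IsBernoulliProcess μ Z α)
    (hY : ∀ n ω, Y n ω = xor (X n ω) (Z n ω)) {n : ℕ}
    (hWZ : IndepFun (W n) (Z n) μ)
    (hind : IndepFun (fun ω => (fun i : Fin (n + 1) => X i ω, fun i : Fin n => Z i ω))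
      (fun ω => (W n ω, Z n ω)) μ) (s : Fin n → Bool) (c : Bool) :
    pastWeights μ X Y (Fin.snoc s c : Fin (n + 1) → Bool)
      = filterStep α q c (pastWeights μ X Y s) := by
  have hinter : ∀ b d e : Bool, μ.real (pastEvent X Y s b ∩ (W n ⁻¹' {d} ∩ Z n ⁻¹' {e}))
      = μ.real (pastEvent X Y s b) * (bernoulliWeight q d * bernoulliWeight α e) := by
    intro b d e
    have h1 := hind.measure_inter_preimage_eq_mul
      {p | (∀ i : Fin n, xor (p.1 i.castSucc) (p.2 i) = s i) ∧ p.1 (Fin.last n) = b}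
      ({d} ×ˢ {e}) (Set.toFinite _).measurableSet (Set.toFinite _).measurableSet
    have h2 := hWZ.measure_inter_preimage_eq_mul {d} {e} (measurableSet_singleton _)
      (measurableSet_singleton _)
    have hE : pastEvent X Y s b = (fun ω => (fun i : Fin (n + 1) => X i ω, fun i : Fin n => Z i ω))
        ⁻¹' {p | (∀ i : Fin n, xor (p.1 i.castSucc) (p.2 i) = s i) ∧ p.1 (Fin.last n) = b} := by
      ext ω
      simp [pastEvent, hY]
    rw [Set.mk_preimage_prod, ← hE, h2] at h1
    rw [measureReal_def, h1, ENNReal.toReal_mul, ENNReal.toReal_mul, ← measureReal_def,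
      ← measureReal_def, ← measureReal_def, hW.measureReal_eq, hZ.measureReal_eq]
  -- Given the state at time `n`, the output `c` and next state `b'` determine the noise and the
  -- flip.
  have hsplit : ∀ b' : Bool, pastEvent X Y (Fin.snoc s c : Fin (n + 1) → Bool) b'
      = (pastEvent X Y s false ∩ (W n ⁻¹' {b'} ∩ Z n ⁻¹' {c}))
        ∪ (pastEvent X Y s true ∩ (W n ⁻¹' {!b'} ∩ Z n ⁻¹' {!c})) := by
    intro b'
    ext ω
    simp only [pastEvent, Set.mem_ofPred_eq, Set.mem_union, Set.mem_inter_iff, Set.mem_preimage,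
      Set.mem_singleton_iff, Fin.forall_fin_succ', Fin.snoc_castSucc, Fin.snoc_last,
      Fin.val_castSucc, Fin.val_last, hstep, hY n]
    generalize (∀ i : Fin n, Y i ω = s i) = P
    cases X n ω <;> cases W n ω <;> cases Z n ω <;> cases c <;> cases b' <;> simp
  have hdisj : ∀ A B : Set Ω, Disjoint (pastEvent X Y s false ∩ A) (pastEvent X Y s true ∩ B) := by
    intro A B
    rw [Set.disjoint_left]
    rintro ω ⟨⟨-, h1⟩, -⟩ ⟨⟨-, h2⟩, -⟩
    rw [h1] at h2
    exact Bool.false_ne_true h2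
  have hmeas : ∀ b d e, MeasurableSet (pastEvent X Y s b ∩ (W n ⁻¹' {d} ∩ Z n ⁻¹' {e})) :=
    fun b d e => (measurableSet_pastEvent mX mY s b).inter
      ((hW.measurable n (measurableSet_singleton _)).inter
        (hZ.measurable n (measurableSet_singleton _)))
  have hval : ∀ b', μ.real (pastEvent X Y (Fin.snoc s c : Fin (n + 1) → Bool) b')
      = μ.real (pastEvent X Y s false) * (bernoulliWeight q b' * bernoulliWeight α c)
        + μ.real (pastEvent X Y s true) * (bernoulliWeight q (!b') * bernoulliWeight α (!c)) := by
    intro b'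
    rw [hsplit, measureReal_union (hdisj _ _) (hmeas _ _ _), hinter, hinter]
  ext
  · simp only [pastWeights, hval, filterStep, predict, observe, bernoulliWeight, Bool.not_false,
      if_true, Bool.false_eq_true, if_false]
    ring
  · simp only [pastWeights, hval, filterStep, predict, observe, bernoulliWeight, Bool.not_true,
      if_true, Bool.false_eq_true, if_false]
    ring

lemma entropy_block {X Y : ℕ → Ω → Bool} (mX : ∀ n, Measurable (X n))
    (mY : ∀ n, Measurable (Y n)) (n : ℕ) :
    entropy μ (fun ω (i : Fin n) => Y i ω)
      = ∑ s : Fin n → Bool, entropyTerm (pastWeights μ X Y s) := by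
  rw [entropy, ← Finset.sum_neg_distrib]
  refine Finset.sum_congr rfl fun s _ => ?_
  have hu : (fun ω (i : Fin n) => Y i ω) ⁻¹' {s} = pastEvent X Y s false ∪ pastEvent X Y s true := by
    ext ω
    simp only [Set.mem_preimage, Set.mem_singleton_iff, Set.mem_union, pastEvent,
      Set.mem_ofPred_eq, funext_iff]
    cases X n ω <;> simp
  have hd : Disjoint (pastEvent X Y s false) (pastEvent X Y s true) := by
    rw [Set.disjoint_left]
    rintro ω ⟨-, h1⟩ ⟨-, h2⟩
    rw [h1] at h2
    exact Bool.false_ne_true h2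
  rw [hu, measureReal_union hd (measurableSet_pastEvent mX mY s true)]
  rfl

end Innovations

end HiddenMarkov

end

theorem theorem6 {Ω : Type*} [MeasurableSpace Ω] (μ : Measure Ω) [IsProbabilityMeasure μ]
    (α q : ℝ) (hα0 : 0 < α) (hα : α ≤ 1 / 2) (hq0 : 0 < q) (hq : q ≤ 1 / 2)
    (X Z Y : ℕ → Ω → Bool)
    (hX : HiddenMarkov.IsSymmetricMarkov μ X q)
    (hZ : HiddenMarkov.IsBernoulliProcess μ Z α)
    (hXZ : IndepFun (fun ω n => X n ω) (fun ω n => Z n ω) μ)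
    (hY : ∀ n ω, Y n ω = xor (X n ω) (Z n ω)) :
    (∃ F : ℝ, HiddenMarkov.IsFstar α q F) ∧
    ∃ H : ℝ, HiddenMarkov.HasEntropyRate μ Y H ∧
      ∀ F : ℝ, HiddenMarkov.IsFstar α q F →
        H ≥ HiddenMarkov.h (HiddenMarkov.binConv α q)
            + (1 - HiddenMarkov.h (HiddenMarkov.binConv α q)) * HiddenMarkov.g α q F ∧
        H ≥ HiddenMarkov.h (HiddenMarkov.binConv α q)
            + (1 - HiddenMarkov.h (HiddenMarkov.binConv α q)) * (4 * HiddenMarkov.g α q F) := by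
  have hη := HiddenMarkov.one_le_eta hα0 hα
  refine ⟨HiddenMarkov.exists_isFstar hα0 hα hq0 hq, ?_⟩
  obtain ⟨H, hlim, hH⟩ := HiddenMarkov.exists_tendsto_entropy hα0 hα hq0 hq
  obtain ⟨W, hW, hXW, hstep⟩ := hX.exists_flips
  have hx : Measurable fun p : Bool × Bool => xor p.1 p.2 := Measurable.of_discrete
  have mX : ∀ n, Measurable (X n) := by
    intro n
    induction n with
    | zero => exact hX.measurable_init
    | succ n ih =>
      rw [show X (n + 1) = (fun p : Bool × Bool => xor p.1 p.2) ∘ fun ω => (X n ω, W n ω) from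
        funext (hstep n)]
      exact hx.comp (ih.prodMk (hW.measurable n))
  have mY : ∀ n, Measurable (Y n) := by
    intro n
    rw [show Y n = (fun p : Bool × Bool => xor p.1 p.2) ∘ fun ω => (X n ω, Z n ω) from
      funext (hY n)]
    exact hx.comp ((mX n).prodMk (hZ.measurable n))
  have hWZ : ∀ n, IndepFun (W n) (Z n) μ := by
    intro n
    have hp : Measurable fun x : ℕ → Bool => (x n, x (n + 1)) := by fun_prop
    have h := hXZ.comp (hx.comp hp) (measurable_pi_apply n)
    have e : W n = ((fun p : Bool × Bool => xor p.1 p.2) ∘ fun x : ℕ → Bool => (x n, x (n + 1)))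
        ∘ fun ω n => X n ω := by
      ext ω : 1
      simp [hstep]
    rw [e]
    exact h
  have h0 : ∀ b, μ.real (X 0 ⁻¹' {b}) = 1 / 2 := by
    have ht : μ.real (X 0 ⁻¹' {true}) = 1 / 2 := hX.prob_init
    rintro (_ | _)
    · have : X 0 ⁻¹' {false} = (X 0 ⁻¹' {true})ᶜ := by
        ext ω
        simp
      rw [this, probReal_compl_eq_one_sub (mX 0 (measurableSet_singleton _)), ht]
      norm_num
    · exact ht
  refine ⟨H, ?_, fun F hF => ?_⟩
  · refine hlim.congr fun n => ?_
    rw [HiddenMarkov.blockEntropyRate, HiddenMarkov.entropy_block mX mY,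
      HiddenMarkov.sum_pastWeights h0 fun n s c =>
        HiddenMarkov.pastWeights_snoc mX mY hW hstep hZ hY (hWZ n)
          (HiddenMarkov.indepFun_innovation hX.measurable_init hW hXW hstep hZ hXZ n) s c]
  · have ha0 := HiddenMarkov.binConv_pos hα0 hα hq0 hq
    have ha := HiddenMarkov.binConv_le_half hα hq
    have strong := hH F (hF.isMinOn hα0 hα hq0 hq)
    have hF1 := (HiddenMarkov.candidates_subset (HiddenMarkov.one_le_Fmax hη hq0 hq) hF.1).1
    have hg := HiddenMarkov.g_nonneg (α := α) (q := q) (F := F) (by linarith) ha0.le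
      (by linarith) (by linarith)
    have hh := HiddenMarkov.h_le_one ha0 (by linarith)
    -- The weaker bound follows since `(1 - h) g ≥ 0`.
    refine ⟨le_trans ?_ strong, strong⟩
    have := mul_nonneg (sub_nonneg.2 hh) hg
    linarith
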